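/- Types are generated by $\varphi ::= p_i \mid \varphi \to \varphi \mid \varphi \times \varphi \mid \bigcirc\varphi$ ($i \in \mathbb{N}$). Terms, taken up to renaming of bound variables, are generated by $$M ::= x \mid \lambda x.M \mid M M \mid \langle M, M\rangle \mid \pi_1 M \mid \pi_2 M \mid \mathbf{pure}\ M \mid \mathbf{let}\ \bigcirc\, x_1,\dots,x_k = M_1,\dots,M_k\ \mathbf{in}\ N \quad (k \ge 0),$$ where in the last form $x_1,\dots,x_k$ are distinct, are bound in $N$, and include all free variables of $N$; so the free variables of that term are those of $M_1,\dots,M_k$, and $(\mathbf{let}\ \bigcirc\,\vec x = \vec M\ \mathbf{in}\ N)[y := P] = \mathbf{let}\ \bigcirc\,\vec x = \vec M[y := P]\ \mathbf{in}\ N$. The modal lambda calculus $\lambda_{\mathbf{IEL}^-}$ has the usual (Curry-style) typing rules of the simply typed lambda calculus for variables, $\to$ and $\times$, together with - if $\Gamma \vdash M : \varphi$, then $\Gamma \vdash \mathbf{pure}\ M : \bigcirc\varphi$; - if $\Gamma \vdash M_i : \bigcirc\varphi_i$ for $i = 1, \dots, k$ and $x_1 : \varphi_1, \dots, x_k : \varphi_k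 \vdash N : \psi$, then $\Gamma \vdash \mathbf{let}\ \bigcirc\,\vec x = \vec M\ \mathbf{in}\ N : \bigcirc\psi$. One-step reduction $\to_\beta$ is the closure under all term constructors of the rules 1. $(\lambda x.M)N \to_\beta M[x := N]$; 2. $\pi_1\langle M,N\rangle \to_\beta M$; 3. $\pi_2\langle M,N\rangle \to_\beta N$; 4. $\mathbf{let}\ \bigcirc\,\vec x, y, \vec z = \vec M, (\mathbf{let}\ \bigcirc\,\vec w = \vec N\ \mathbf{in}\ Q), \vec P\ \mathbf{in}\ R \ \to_\beta\ \mathbf{let}\ \bigcirc\,\vec x, \vec w, \vec z = \vec M, \vec N, \vec P\ \mathbf{in}\ R[y := Q]$ (with $\vec w$ renamed apart from $\vec x$ and $\vec z$); 5. $\mathbf{let}\ \bigcirc\,\vec x = \mathbf{pure}\ \vec M\ \mathbf{in}\ N \ \to_\beta\ \mathbf{pure}\ N[\vec x := \vec M]$, where $\mathbf{pure}\ \vec M$ is $\mathbf{pure}\ M_1, \dots, \mathbf{pure}\ M_k$; 6. $\mathbf{let}\ \bigcirc\,\_ = \_\ \mathbf{in}\ M \ \to_\beta\ \mathbf{pure}\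 M$, where $\_$ is the empty sequence. **Theorem.** Reduction in $\lambda_{\mathbf{IEL}^-}$ is strongly normalising: if $\Gamma \vdash M : \varphi$ for some context $\Gamma$ and type $\varphi$, then there is no infinite sequence $M = M_0 \to_\beta M_1 \to_\beta M_2 \to_\beta \cdots$. -/

import Mathlib

namespace IELMinus

/-- Types: atoms `p_0, p_1, …`, function types, product types and modal types. -/
inductive Ty : Type
  | atom (i : ℕ) : Ty
  | arr (φ ψ : Ty) : Ty
  | prod (φ ψ : Ty) : Ty
  | circ (φ : Ty) : Ty

/-- Terms up to α-equivalence, as well-scoped de Bruijn terms: `Term n` is the set of terms whose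
free variables are among `n` given distinct variables, which are numbered by `Fin n`.
`lam M` binds variable `0` of `M`; `letin k Ms N` is `let ○ x₁, …, x_k = M₁, …, M_k in N`, where `N`
has no variables but the `k` bound variables `x₁, …, x_k`, so that the free variables of the whole
term are those of `M₁, …, M_k`. -/
inductive Term : ℕ → Type
  | var {n : ℕ} (i : Fin n) : Term n
  | lam {n : ℕ} (M : Term (n + 1)) : Term n
  | app {n : ℕ} (M N : Term n) : Term n
  | pair {n : ℕ} (M N : Term n) : Term n
  | fst {n : ℕ} (M : Term n) : Term n
  | snd {n : ℕ} (M : Term n) : Term n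
  | pure {n : ℕ} (M : Term n) : Term n
  | letin {n : ℕ} (k : ℕ) (Ms : Fin k → Term n) (N : Term k) : Term n

/-- A context declares a type for each of `n` variables. -/
abbrev Ctx (n : ℕ) : Type := Fin n → Ty

namespace Ctx

/-- The context `Γ, x : φ`; the new variable has index `0`. -/
def snoc {n : ℕ} (Γ : Ctx n) (φ : Ty) : Ctx (n + 1) :=
  Fin.cons (α := fun _ => Ty) φ Γ

end Ctx

/-- The typing relation `Γ ⊢ M : φ`. -/
inductive Typing : {n : ℕ} → Ctx n → Term n → Ty → Prop
  | ax {n : ℕ} (Γ : Ctx n) (i : Fin n) : Typing Γ (Term.var i) (Γ i)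
  | lam {n : ℕ} {Γ : Ctx n} {φ ψ : Ty} {M : Term (n + 1)} :
      Typing (Γ.snoc φ) M ψ → Typing Γ (Term.lam M) (Ty.arr φ ψ)
  | app {n : ℕ} {Γ : Ctx n} {φ ψ : Ty} {M N : Term n} :
      Typing Γ M (Ty.arr φ ψ) → Typing Γ N φ → Typing Γ (Term.app M N) ψ
  | pair {n : ℕ} {Γ : Ctx n} {φ ψ : Ty} {M N : Term n} :
      Typing Γ M φ → Typing Γ N ψ → Typing Γ (Term.pair M N) (Ty.prod φ ψ)
  | fst {n : ℕ} {Γ : Ctx n} {φ ψ : Ty} {M : Term n} :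
      Typing Γ M (Ty.prod φ ψ) → Typing Γ (Term.fst M) φ
  | snd {n : ℕ} {Γ : Ctx n} {φ ψ : Ty} {M : Term n} :
      Typing Γ M (Ty.prod φ ψ) → Typing Γ (Term.snd M) ψ
  | pure {n : ℕ} {Γ : Ctx n} {φ : Ty} {M : Term n} :
      Typing Γ M φ → Typing Γ (Term.pure M) (Ty.circ φ)
  | letin {n : ℕ} {Γ : Ctx n} {k : ℕ} {φs : Ctx k} {ψ : Ty} {Ms : Fin k → Term n} {N : Term k} :
      (∀ i, Typing Γ (Ms i) (Ty.circ (φs i))) → Typing φs N ψ →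
      Typing Γ (Term.letin k Ms N) (Ty.circ ψ)

namespace Term

/-- Renaming of the free variables. The body of a `let` contains none of them. -/
def rename : {n m : ℕ} → (Fin n → Fin m) → Term n → Term m
  | _, _, ρ, var i => var (ρ i)
  | _, _, ρ, lam M => lam (rename (Fin.cons (α := fun _ => Fin _) 0 (fun i => (ρ i).succ)) M)
  | _, _, ρ, app M N => app (rename ρ M) (rename ρ N)
  | _, _, ρ, pair M N => pair (rename ρ M) (rename ρ N)
  | _, _, ρ, fst M => fst (rename ρ M)
  | _, _, ρ, snd M => snd (rename ρ M)
  | _, _, ρ, pure M => pure (rename ρ M)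
  | _, _, ρ, letin k Ms N => letin k (fun i => rename ρ (Ms i)) N

/-- Simultaneous capture-avoiding substitution of `σ i` for the variable `i`. -/
def subst : {n m : ℕ} → (Fin n → Term m) → Term n → Term m
  | _, _, σ, var i => σ i
  | _, _, σ, lam M =>
      lam (subst (Fin.cons (α := fun _ => Term _) (var 0) (fun i => rename Fin.succ (σ i))) M)
  | _, _, σ, app M N => app (subst σ M) (subst σ N)
  | _, _, σ, pair M N => pair (subst σ M) (subst σ N)
  | _, _, σ, fst M => fst (subst σ M)
  | _, _, σ, snd M => snd (subst σ M)
  | _, _, σ, pure M => pure (subst σ M)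
  | _, _, σ, letin k Ms N => letin k (fun i => subst σ (Ms i)) N

/-- `M [x := N]`, where `x` is the variable of `M` with index `0`. -/
def inst {n : ℕ} (M : Term (n + 1)) (N : Term n) : Term n :=
  subst (Fin.cons (α := fun _ => Term n) N var) M

/-- The concatenation `M₁, …, M_a, N₁, …, N_b, P₁, …, P_c` of three sequences. -/
def append₃ {n a b c : ℕ} (Ms : Fin a → Term n) (Ns : Fin b → Term n) (Ps : Fin c → Term n) :
    Fin (a + b + c) → Term n :=
  Fin.append (Fin.append Ms Ns) Ps

/-- For `R` with variables `x₁, …, x_a, y, z₁, …, z_c` and `Q` with variables `w₁, …, w_b`, the term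
`R [y := Q]` with variables `x₁, …, x_a, w₁, …, w_b, z₁, …, z_c`. -/
def substMiddle {a b c : ℕ} (R : Term (a + 1 + c)) (Q : Term b) : Term (a + b + c) :=
  subst
    (append₃
      (fun i : Fin a => var (Fin.castAdd c (Fin.castAdd b i)))
      (fun _ : Fin 1 => rename (fun j => Fin.castAdd c (Fin.natAdd a j)) Q)
      (fun k : Fin c => var (Fin.natAdd (a + b) k)))
    R

end Term

open Term in
/-- The `β`-reduction rules, applied at the root of a term. -/
inductive Contract : {n : ℕ} → Term n → Term n → Prop
  | beta {n : ℕ} (M : Term (n + 1)) (N : Term n) :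
      Contract (app (lam M) N) (inst M N)
  | fst {n : ℕ} (M N : Term n) : Contract (fst (pair M N)) M
  | snd {n : ℕ} (M N : Term n) : Contract (snd (pair M N)) N
  | letLet {n a b c : ℕ} (Ms : Fin a → Term n) (Ns : Fin b → Term n) (Q : Term b)
      (Ps : Fin c → Term n) (R : Term (a + 1 + c)) :
      Contract
        (letin (a + 1 + c) (append₃ Ms (fun _ : Fin 1 => letin b Ns Q) Ps) R)
        (letin (a + b + c) (append₃ Ms Ns Ps) (substMiddle R Q))
  | letPure {n k : ℕ} (Ms : Fin k → Term n) (N : Term k) :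
      Contract (letin k (fun i => pure (Ms i)) N) (pure (subst Ms N))
  | letEmpty {n : ℕ} (Ms : Fin 0 → Term n) (M : Term 0) :
      Contract (letin 0 Ms M) (pure (rename Fin.elim0 M))

open Term in
/-- One-step `β`-reduction: the closure of the rules under all term constructors. -/
inductive Step : {n : ℕ} → Term n → Term n → Prop
  | root {n : ℕ} {M M' : Term n} : Contract M M' → Step M M'
  | lam {n : ℕ} {M M' : Term (n + 1)} : Step M M' → Step (lam M) (lam M')
  | appL {n : ℕ} {M M' : Term n} (N : Term n) : Step M M' → Step (app M N) (app M' N)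
  | appR {n : ℕ} (M : Term n) {N N' : Term n} : Step N N' → Step (app M N) (app M N')
  | pairL {n : ℕ} {M M' : Term n} (N : Term n) : Step M M' → Step (pair M N) (pair M' N)
  | pairR {n : ℕ} (M : Term n) {N N' : Term n} : Step N N' → Step (pair M N) (pair M N')
  | fst {n : ℕ} {M M' : Term n} : Step M M' → Step (fst M) (fst M')
  | snd {n : ℕ} {M M' : Term n} : Step M M' → Step (snd M) (snd M')
  | pure {n : ℕ} {M M' : Term n} : Step M M' → Step (pure M) (pure M')
  | letArg {n k : ℕ} (Ms : Fin k → Term n) (i : Fin k) {M' : Term n} (N : Term k) :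
      Step (Ms i) M' → Step (letin k Ms N) (letin k (Function.update Ms i M') N)
  | letBody {n k : ℕ} (Ms : Fin k → Term n) {N N' : Term k} :
      Step N N' → Step (letin k Ms N) (letin k Ms N')

/-- `M` is strongly normalising: no infinite sequence of one-step reductions starts from `M`. -/
def StronglyNormalising {n : ℕ} (M : Term n) : Prop :=
  ¬ ∃ f : ℕ → Term n, f 0 = M ∧ ∀ i, Step (f i) (f (i + 1))

end IELMinus

/-!
Typed terms are interpreted by hereditarily increasing functionals in such a way that every
reduction step strictly decreases the value; since each value has a size in `ℕ`, reduction
terminates.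

* A type is interpreted by a `Sized` set: a preordered set with an action of `ℕ` by increments and a
  monotone size. "Strictly smaller" means `1 +ᵥ a ≤ b`. Atoms are read as `ℕ`, and `φ → ψ` as the
  functions that pass increments on (`Arr`). The type `○φ` is read as in a continuation-passing
  translation, by functionals `(φ →o ℕ) → ℕ` that pass increments on (`Cont`).
* `let ○ x₁, …, x_k = M₁, …, M_k in N` is read as `k ↦ 1 + M₁ (x₁ ↦ … M_k (x_k ↦ k N + size N) …)`,
  and `pure M` as `k ↦ k M + size M`. The flattening rule then amounts to the associativity of
  running one sequence of functionals after another (`Cont.seq_append`, `Cont.seq_flatten`); the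
  constants `1` make it strict, and the summands `size` make subterms matter whose value the
  continuation may ignore.
* Abstractions, pairs and projections are padded in the same way, so that the rules for functions
  and pairs are strict and no subterm is erased.

A term of the Curry-style calculus may have several typing derivations, and therefore several
values; `Den` relates it to all of them. The core is `Step.exists_den_lt`: a reduct of a term with
value `f` has a value that is smaller than `f` by at least `1` in every environment. Its only
syntactic ingredients are the lemmas `Den.rename` and `Den.subst` on renaming and substitution.
-/

namespace IELMinus

/-! ### Monotonicity of operations on finite sequences -/

section

variable {X : Type} [Preorder X]

theorem cons_le_cons {m : ℕ} {x y : X} {xs ys : Fin m → X} (h : x ≤ y) (hs : xs ≤ ys) :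
    (Fin.cons x xs : Fin (m + 1) → X) ≤ Fin.cons y ys := by
  intro i
  refine Fin.cases ?_ (fun j => ?_) i
  · simpa using h
  · simpa using hs j

theorem snoc_le_snoc {m : ℕ} {xs ys : Fin m → X} {x y : X} (hs : xs ≤ ys) (h : x ≤ y) :
    (Fin.snoc xs x : Fin (m + 1) → X) ≤ Fin.snoc ys y := by
  intro i
  refine Fin.lastCases ?_ (fun j => ?_) i
  · simpa using h
  · simpa using hs j

theorem append_le_append {a b : ℕ} {xs xs' : Fin a → X} {ys ys' : Fin b → X} (hx : xs ≤ xs')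
    (hy : ys ≤ ys') : Fin.append xs ys ≤ Fin.append xs' ys' := by
  intro i
  refine Fin.addCases (fun j => ?_) (fun j => ?_) i
  · simpa using hx j
  · simpa using hy j

theorem forall_fin_add_add {a b c : ℕ} {P : Fin (a + b + c) → Prop}
    (h₁ : ∀ i : Fin a, P (Fin.castAdd c (Fin.castAdd b i)))
    (h₂ : ∀ i : Fin b, P (Fin.castAdd c (Fin.natAdd a i)))
    (h₃ : ∀ i : Fin c, P (Fin.natAdd (a + b) i)) (i : Fin (a + b + c)) : P i :=
  Fin.addCases (fun i => Fin.addCases h₁ h₂ i) h₃ i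

end

/-! ### Ordered sets of values -/

/-- A preordered set of values on which `ℕ` acts by increments, with a natural number `size a`
attached to each value. The relation `1 +ᵥ a ≤ b` plays the part of the strict order. -/
class Sized (α : Type) extends Preorder α, AddAction ℕ α where
  /-- The size of a value. -/
  size : α → ℕ
  /-- A value at which functions are evaluated to determine their size. -/
  base : α
  vadd_mono {a b : α} (n : ℕ) : a ≤ b → n +ᵥ a ≤ n +ᵥ b
  le_vadd (n : ℕ) (a : α) : a ≤ n +ᵥ a
  size_mono {a b : α} {n : ℕ} : n +ᵥ a ≤ b → n + size a ≤ size b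

namespace Sized

variable {α : Type} [Sized α]

theorem vadd_le_vadd {a b : α} {m n : ℕ} (hmn : m ≤ n) (hab : a ≤ b) : m +ᵥ a ≤ n +ᵥ b := by
  obtain ⟨l, rfl⟩ := Nat.exists_eq_add_of_le' hmn
  rw [add_vadd]
  exact (vadd_mono m hab).trans (le_vadd l _)

theorem size_le_size {a b : α} (h : a ≤ b) : size a ≤ size b := by
  simpa using size_mono (n := 0) (a := a) (b := b) (by simpa using h)

theorem le_of_vadd_le {a b : α} {n : ℕ} (h : n +ᵥ a ≤ b) : a ≤ b := (le_vadd n a).trans h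

theorem vadd_vadd_le {a b : α} {l m n : ℕ} (hmn : l + m ≤ n) (h : a ≤ b) :
    l +ᵥ m +ᵥ a ≤ n +ᵥ b := by
  rw [← add_vadd]
  exact vadd_le_vadd hmn h

end Sized

open Sized (size base)

instance : Sized ℕ where
  size := id
  base := 0
  vadd_mono n h := Nat.add_le_add_left h n
  le_vadd n a := Nat.le_add_left a n
  size_mono h := h

/-- Pairs are ordered and incremented componentwise, so that `1 +ᵥ p ≤ q` demands a decrease in both
components. -/
instance {α β : Type} [Sized α] [Sized β] : Sized (α × β) where
  size p := size p.1
  base := (base, base)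
  vadd_mono n h := ⟨Sized.vadd_mono n h.1, Sized.vadd_mono n h.2⟩
  le_vadd n p := ⟨Sized.le_vadd n p.1, Sized.le_vadd n p.2⟩
  size_mono h := Sized.size_mono h.1

/-- Functions that turn an increment of the argument by `n` into an increment of the value by at
least `n`. For `n = 0` this says that they are monotone. -/
structure Arr (α β : Type) [Sized α] [Sized β] where
  /-- The underlying function. -/
  toFun : α → β
  incr {a b : α} (n : ℕ) : n +ᵥ a ≤ b → n +ᵥ toFun a ≤ toFun b

namespace Arr

variable {α β : Type} [Sized α] [Sized β]

theorem mono (f : Arr α β) {a b : α} (h : a ≤ b) : f.toFun a ≤ f.toFun b := by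
  simpa using f.incr 0 (by simpa using h)

theorem ext {f g : Arr α β} (h : ∀ a, f.toFun a = g.toFun a) : f = g := by
  cases f
  cases g
  congr
  exact funext h

instance : Sized (Arr α β) where
  le f g := ∀ a, f.toFun a ≤ g.toFun a
  le_refl f a := le_rfl
  le_trans f g h hfg hgh a := (hfg a).trans (hgh a)
  vadd n f :=
    ⟨fun a => n +ᵥ f.toFun a, fun m h => by
      rw [vadd_comm]
      exact Sized.vadd_mono n (f.incr m h)⟩
  zero_vadd f := ext fun a => zero_vadd ℕ _
  add_vadd m n f := ext fun a => add_vadd m n _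
  size f := size (f.toFun base)
  -- A constant function does not pass increments on, whence the summand `size a`.
  base := ⟨fun a => size a +ᵥ base, fun n h => Sized.vadd_vadd_le (Sized.size_mono h) le_rfl⟩
  vadd_mono n h a := Sized.vadd_mono n (h a)
  le_vadd n f a := Sized.le_vadd n _
  size_mono h := Sized.size_mono (h base)

end Arr

/-- Functionals on the monotone functions `X →o ℕ` that turn an increment of the argument by `n`
into an increment of the value by at least `n`. -/
structure Cont (X : Type) [Preorder X] where
  /-- The underlying functional. -/
  toFun : (X →o ℕ) → ℕ
  incr {k l : X →o ℕ} (n : ℕ) : (∀ x, n + k x ≤ l x) → n + toFun k ≤ toFun l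

namespace Cont

variable {X Y : Type} [Preorder X] [Preorder Y]

theorem mono (F : Cont X) {k l : X →o ℕ} (h : ∀ x, k x ≤ l x) : F.toFun k ≤ F.toFun l := by
  simpa using F.incr 0 (by simpa using h)

theorem ext {F G : Cont X} (h : ∀ k, F.toFun k = G.toFun k) : F = G := by
  cases F
  cases G
  congr
  exact funext h

instance [Inhabited X] : Sized (Cont X) where
  le F G := ∀ k, F.toFun k ≤ G.toFun k
  le_refl F k := le_rfl
  le_trans F G H hFG hGH k := (hFG k).trans (hGH k)
  vadd n F := ⟨fun k => n + F.toFun k, fun m h => by have := F.incr m h; omega⟩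
  zero_vadd F := ext fun k => Nat.zero_add _
  add_vadd m n F := ext fun k => Nat.add_assoc _ _ _
  size F := F.toFun ⟨fun _ => 0, fun _ _ _ => le_rfl⟩
  base := ⟨fun k => k default, fun n h => h _⟩
  vadd_mono n h k := Nat.add_le_add_left (h k) n
  le_vadd n F k := Nat.le_add_left _ _
  size_mono h := h _

/-- The image of a functional under a monotone map. -/
def map (f : X →o Y) (F : Cont X) : Cont Y :=
  ⟨fun k => F.toFun (k.comp f), fun n h => F.incr n fun x => h (f x)⟩

/-- The continuation of a sequence that runs `B` to obtain one more entry and then continues as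
`b`. -/
def snocHom {m : ℕ} (B : Cont X) (b : (Fin (m + 1) → X) →o ℕ) : (Fin m → X) →o ℕ where
  toFun xs := B.toFun ⟨fun x => b (Fin.snoc xs x), fun _ _ h => b.mono (snoc_le_snoc le_rfl h)⟩
  monotone' _ _ h := B.mono fun _ => b.mono (snoc_le_snoc h le_rfl)

/-- The functional that runs `A` to obtain a sequence and then `B` to obtain its last entry. -/
def snoc {m : ℕ} (A : Cont (Fin m → X)) (B : Cont X) : Cont (Fin (m + 1) → X) where
  toFun b := A.toFun (snocHom B b)
  incr n h := A.incr n fun _ => B.incr n fun _ => h _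

/-- The functional that runs `F 0, F 1, …` in this order to obtain the entries of a sequence. -/
def seq : {m : ℕ} → (Fin m → Cont X) → Cont (Fin m → X)
  | 0, _ => ⟨fun b => b Fin.elim0, fun _ h => h _⟩
  | _ + 1, F => snoc (seq (Fin.init F)) (F (Fin.last _))

theorem seq_mono : {m : ℕ} → {F G : Fin m → Cont X} → (∀ i k, (F i).toFun k ≤ (G i).toFun k) →
    ∀ b, (seq F).toFun b ≤ (seq G).toFun b
  | 0, _, _, _, _ => le_rfl
  | _ + 1, _, G, h, _ =>
    (seq_mono (fun i => h i.castSucc) _).trans ((seq (Fin.init G)).mono fun _ => h _ _)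

/-- It suffices that one member of a sequence increases by `n`, since the functionals run before it
pass the increment on. -/
theorem seq_incr : {m : ℕ} → {F G : Fin m → Cont X} → {n : ℕ} → (j : Fin m) →
    (∀ i k, (F i).toFun k ≤ (G i).toFun k) → (∀ k, n + (F j).toFun k ≤ (G j).toFun k) →
    ∀ b, n + (seq F).toFun b ≤ (seq G).toFun b
  | m + 1, F, G, n, j, h, hj, b => by
    revert hj
    refine Fin.lastCases (fun hj => ?_) (fun j hj => ?_) j
    · exact ((seq (Fin.init F)).incr n fun _ => hj _).trans
        (seq_mono (fun i => h i.castSucc) _)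
    · exact (seq_incr (F := Fin.init F) (G := Fin.init G) j (fun i => h i.castSucc) hj _).trans
        ((seq (Fin.init G)).mono fun _ => h _ _)

/-- If each `F i` dominates evaluation at `x i`, then running the sequence dominates evaluation
at `x`. -/
theorem le_seq : {m : ℕ} → {F : Fin m → Cont X} → (x : Fin m → X) →
    (∀ i (k : X →o ℕ), k (x i) ≤ (F i).toFun k) → ∀ b : (Fin m → X) →o ℕ, b x ≤ (seq F).toFun b
  | 0, _, x, _, b => (congrArg b (Subsingleton.elim x Fin.elim0)).le
  | m + 1, F, x, h, b => by
    have hx : b x = b (Fin.snoc (Fin.init x) (x (Fin.last m))) := by rw [Fin.snoc_init_self]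
    rw [hx]
    exact (h (Fin.last m) _).trans
      (le_seq (F := Fin.init F) (Fin.init x) (fun i => h i.castSucc) (snocHom (F (Fin.last m)) b))

/-- A sequence can be run in two parts. -/
theorem seq_append {a : ℕ} (F : Fin a → Cont X) : {b : ℕ} → (G : Fin b → Cont X) →
    ∀ k, (seq (Fin.append F G)).toFun k = (seq F).toFun
      ⟨fun xs => (seq G).toFun
        ⟨fun ys => k (Fin.append xs ys), fun _ _ h => k.mono (append_le_append le_rfl h)⟩,
        fun _ _ h => (seq G).mono fun _ => k.mono (append_le_append h le_rfl)⟩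
  | 0, G, k => by
    have hG : G = Fin.elim0 := Subsingleton.elim _ _
    subst hG
    change (seq (Fin.append F Fin.elim0)).toFun k =
      (seq F).toFun ⟨fun xs => k (Fin.append xs Fin.elim0), _⟩
    congr 1
    · simp
    · ext xs
      simp
  | b + 1, G, k => by
    have hi : Fin.init (Fin.append (m := a) (n := b + 1) F G) =
        Fin.append (m := a) (n := b) F (Fin.init G) := by
      funext i
      refine Fin.addCases (fun j => ?_) (fun j => ?_) i
      · rw [Fin.append_left]
        exact Fin.append_left F G j
      · rw [Fin.append_right]
        exact Fin.append_right F G j.castSucc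
    have hl : Fin.append (m := a) (n := b + 1) F G (Fin.last (a + b)) = G (Fin.last b) :=
      Fin.append_right F G (Fin.last b)
    change (snoc (seq (Fin.init (Fin.append (m := a) (n := b + 1) F G)))
      (Fin.append (m := a) (n := b + 1) F G (Fin.last (a + b)))).toFun k = _
    rw [hi, hl]
    refine (seq_append F (Fin.init G) _).trans ?_
    congr 1
    ext xs
    change (seq (Fin.init G)).toFun _ = (seq (Fin.init G)).toFun _
    congr 1
    ext ys
    change (G (Fin.last b)).toFun _ = (G (Fin.last b)).toFun _
    congr 1
    ext y
    exact congrArg k (Fin.append_snoc xs ys y).symm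

theorem seq_const (F : Cont X) (k : (Fin 1 → X) →o ℕ) :
    (seq fun _ : Fin 1 => F).toFun k =
      F.toFun ⟨fun x => k fun _ => x, fun _ _ h => k.mono fun _ => h⟩ := by
  refine congrArg F.toFun (OrderHom.ext _ _ (funext fun x => congrArg k (funext fun i => ?_)))
  obtain rfl : i = Fin.last 0 := Subsingleton.elim (α := Fin 1) _ _
  rfl

/-- The inequality behind the flattening of nested `let`s: a single functional `G` in the middle of
a sequence that exceeds a sequence `B` followed by the function `y` may be replaced by `B`. -/
theorem seq_flatten {a b c : ℕ} (A : Fin a → Cont X) (B : Fin b → Cont X) (C : Fin c → Cont X)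
    {G : Cont X} {y : (Fin b → X) →o X} (hG : ∀ k, 1 + (seq B).toFun (k.comp y) ≤ G.toFun k)
    {t : (Fin (a + b + c) → X) →o (Fin (a + 1 + c) → X)}
    (ht : ∀ xs ys zs, t (Fin.append (Fin.append xs ys) zs) =
      Fin.append (Fin.append xs fun _ => y ys) zs)
    (k : (Fin (a + 1 + c) → X) →o ℕ) :
    1 + (seq (Fin.append (Fin.append A B) C)).toFun (k.comp t) ≤
      (seq (Fin.append (Fin.append A fun _ : Fin 1 => G) C)).toFun k := by
  simp only [seq_append, seq_const]
  refine (seq A).incr 1 fun xs => le_trans (le_of_eq ?_) (hG _)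
  refine congrArg (fun l => 1 + (seq B).toFun l) (OrderHom.ext _ _ (funext fun ys => ?_))
  refine congrArg (seq C).toFun (OrderHom.ext _ _ (funext fun zs => ?_))
  exact congrArg k (ht xs ys zs)

end Cont

/-! ### Values of types and environments -/

/-- A set of values, bundled with its structure. -/
structure SizedType where
  /-- The set of values. -/
  carrier : Type
  [sized : Sized carrier]

/-- The interpretation of types. A modal type `○φ` is read as the type of functionals on the
monotone functions from the values of `φ` to `ℕ`. -/
def Ty.interp : Ty → SizedType
  | .atom _ => ⟨ℕ⟩
  | .arr φ ψ =>
    letI := φ.interp.sized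
    letI := ψ.interp.sized
    ⟨Arr φ.interp.carrier ψ.interp.carrier⟩
  | .prod φ ψ =>
    letI := φ.interp.sized
    letI := ψ.interp.sized
    ⟨φ.interp.carrier × ψ.interp.carrier⟩
  | .circ φ =>
    letI := φ.interp.sized
    letI : Inhabited φ.interp.carrier := ⟨base⟩
    ⟨Cont φ.interp.carrier⟩

/-- The values of a type. -/
abbrev Sem (φ : Ty) : Type := φ.interp.carrier

instance (φ : Ty) : Sized (Sem φ) := φ.interp.sized

/-- A family of values, one for each type. Environments consist of such families, so that they are
sequences with entries in a fixed set, whatever the context; a variable of type `φ` refers to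
the value at `φ`. -/
abbrev Val : Type := ∀ φ : Ty, Sem φ

open Classical in
/-- The family with value `a` at `φ` and the base value at every other type. -/
noncomputable def Val.single (φ : Ty) : Sem φ →o Val where
  toFun a := Function.update (fun _ => base) φ a
  monotone' a b h ψ := by
    by_cases e : ψ = φ
    · subst e
      simpa using h
    · simp [e]

open Classical in
theorem Val.single_self (φ : Ty) (a : Sem φ) : Val.single φ a φ = a :=
  Function.update_self (β := Sem) φ a fun _ => base

/-- Environments for `n` variables. -/
abbrev Env (n : ℕ) : Type := Fin n → Val

namespace Env

/-- The value of a variable at a type. -/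
def read {n : ℕ} (i : Fin n) (φ : Ty) : Env n →o Sem φ :=
  ⟨fun ρ => ρ i φ, fun _ _ h => h i φ⟩

/-- Reindexing of an environment. -/
def pull {n m : ℕ} (r : Fin n → Fin m) : Env m →o Env n :=
  ⟨fun ρ i => ρ (r i), fun _ _ h i => h (r i)⟩

/-- A map of environments, extended by the identity to a new variable `0`. -/
def lift {n m : ℕ} (t : Env m →o Env n) : Env (m + 1) →o Env (n + 1) :=
  ⟨fun ρ => Fin.cons (ρ 0) (t fun i => ρ i.succ),
    fun _ _ h => cons_le_cons (h 0) (t.mono fun i => h i.succ)⟩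

end Env

/-! ### Values of terms -/

section

variable {n : ℕ} {φ ψ : Ty}

/-- The value of an abstraction. The summand `size a` makes it increase with the argument even if
the bound variable does not occur in the body. -/
noncomputable def semLam (f : Env (n + 1) →o Sem ψ) : Env n →o Sem (.arr φ ψ) where
  toFun ρ :=
    (⟨fun a => (size a + 1) +ᵥ f (Fin.cons (Val.single φ a) ρ), fun m h =>
      Sized.vadd_vadd_le (by have := Sized.size_mono h; omega)
        (f.mono (cons_le_cons ((Val.single φ).mono (Sized.le_of_vadd_le h)) le_rfl))⟩ :
      Arr (Sem φ) (Sem ψ))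
  monotone' _ _ h _ := Sized.vadd_mono _ (f.mono (cons_le_cons le_rfl h))

/-- The value of an application. -/
def semApp (f : Env n →o Sem (.arr φ ψ)) (g : Env n →o Sem φ) : Env n →o Sem ψ where
  toFun ρ := Arr.toFun (α := Sem φ) (β := Sem ψ) (f ρ) (g ρ)
  monotone' ρ τ h :=
    le_trans (f.mono h (g ρ)) (Arr.mono (α := Sem φ) (β := Sem ψ) (f τ) (g.mono h))

/-- The value of a pair. Each component is increased by the size of the other one, so that a
decrease in one of them is felt in both. -/
def semPair (f : Env n →o Sem φ) (g : Env n →o Sem ψ) : Env n →o Sem (.prod φ ψ) where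
  toFun ρ := ((size (g ρ) +ᵥ f ρ, size (f ρ) +ᵥ g ρ) : Sem φ × Sem ψ)
  monotone' _ _ h :=
    ⟨Sized.vadd_le_vadd (Sized.size_le_size (g.mono h)) (f.mono h),
      Sized.vadd_le_vadd (Sized.size_le_size (f.mono h)) (g.mono h)⟩

/-- The value of a first projection. The increment makes the projection rule strict. -/
def semFst (f : Env n →o Sem (.prod φ ψ)) : Env n →o Sem φ where
  toFun ρ := 1 +ᵥ Prod.fst (α := Sem φ) (β := Sem ψ) (f ρ)
  monotone' _ _ h := Sized.vadd_mono 1 (f.mono h).1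

/-- The value of a second projection. The increment makes the projection rule strict. -/
def semSnd (f : Env n →o Sem (.prod φ ψ)) : Env n →o Sem ψ where
  toFun ρ := 1 +ᵥ Prod.snd (α := Sem φ) (β := Sem ψ) (f ρ)
  monotone' _ _ h := Sized.vadd_mono 1 (f.mono h).2

/-- The function `a ↦ size a + k a`; the first summand makes it increase strictly with `a`. -/
def addSize (k : Sem φ →o ℕ) : Sem φ →o ℕ :=
  ⟨fun a => size a + k a, fun _ _ h => Nat.add_le_add (Sized.size_le_size h) (k.mono h)⟩

theorem addSize_incr (k : Sem φ →o ℕ) {m : ℕ} {a b : Sem φ} (h : m +ᵥ a ≤ b) :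
    m + addSize k a ≤ addSize k b := by
  have h1 := Sized.size_mono h
  have h2 := k.mono (Sized.le_of_vadd_le h)
  change m + (size a + k a) ≤ size b + k b
  omega

/-- The value of `pure`: hand the value of the argument on. -/
def semPure (f : Env n →o Sem φ) : Env n →o Sem (.circ φ) where
  toFun ρ := (⟨fun k => addSize k (f ρ), fun m h => by
    have := h (f ρ)
    change m + (_ + _) ≤ _ + _
    omega⟩ : Cont (Sem φ))
  monotone' _ _ h k := (addSize k).mono (f.mono h)

/-- A value of `○φ` as a functional on functions of families of values. -/
noncomputable def toCont (F : Sem (.circ φ)) : Cont Val :=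
  Cont.map (Val.single φ) (show Cont (Sem φ) from F)

/-- The value of `let`: run the arguments in order and hand the resulting value of the body on. The
summand `1` makes the reduction rules for `let` strict. -/
noncomputable def semLet {k : ℕ} {φs : Ctx k} (fs : ∀ i, Env n →o Sem (.circ (φs i)))
    (g : Env k →o Sem ψ) : Env n →o Sem (.circ ψ) where
  toFun ρ :=
    (⟨fun l => 1 + (Cont.seq fun i => toCont (fs i ρ)).toFun ((addSize l).comp g), fun m h => by
      rw [add_left_comm]
      refine Nat.add_le_add_left ((Cont.seq _).incr m fun x => ?_) 1
      have := h (g x)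
      change m + (_ + _) ≤ _ + _
      omega⟩ : Cont (Sem ψ))
  monotone' _ _ h l := Nat.add_le_add_left (Cont.seq_mono (fun i k => (fs i).mono h _) _) 1

end

/-- `Den Γ M φ f` says that `f` is the value of `M` as a function of the environment, for some
derivation of `Γ ⊢ M : φ`. A relation is used because a term may have several derivations. -/
inductive Den : {n : ℕ} → (Γ : Ctx n) → Term n → (φ : Ty) → (Env n →o Sem φ) → Prop
  | ax {n : ℕ} (Γ : Ctx n) (i : Fin n) : Den Γ (.var i) (Γ i) (Env.read i (Γ i))
  | lam {n : ℕ} {Γ : Ctx n} {φ ψ : Ty} {M : Term (n + 1)} {f : Env (n + 1) →o Sem ψ} :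
      Den (Γ.snoc φ) M ψ f → Den Γ (.lam M) (.arr φ ψ) (semLam f)
  | app {n : ℕ} {Γ : Ctx n} {φ ψ : Ty} {M N : Term n} {f : Env n →o Sem (.arr φ ψ)}
      {g : Env n →o Sem φ} :
      Den Γ M (.arr φ ψ) f → Den Γ N φ g → Den Γ (.app M N) ψ (semApp f g)
  | pair {n : ℕ} {Γ : Ctx n} {φ ψ : Ty} {M N : Term n} {f : Env n →o Sem φ}
      {g : Env n →o Sem ψ} :
      Den Γ M φ f → Den Γ N ψ g → Den Γ (.pair M N) (.prod φ ψ) (semPair f g)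
  | fst {n : ℕ} {Γ : Ctx n} {φ ψ : Ty} {M : Term n} {f : Env n →o Sem (.prod φ ψ)} :
      Den Γ M (.prod φ ψ) f → Den Γ (.fst M) φ (semFst f)
  | snd {n : ℕ} {Γ : Ctx n} {φ ψ : Ty} {M : Term n} {f : Env n →o Sem (.prod φ ψ)} :
      Den Γ M (.prod φ ψ) f → Den Γ (.snd M) ψ (semSnd f)
  | pure {n : ℕ} {Γ : Ctx n} {φ : Ty} {M : Term n} {f : Env n →o Sem φ} :
      Den Γ M φ f → Den Γ (.pure M) (.circ φ) (semPure f)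
  | letin {n : ℕ} {Γ : Ctx n} {k : ℕ} {φs : Ctx k} {ψ : Ty} {Ms : Fin k → Term n} {N : Term k}
      {fs : ∀ i, Env n →o Sem (.circ (φs i))} {g : Env k →o Sem ψ} :
      (∀ i, Den Γ (Ms i) (.circ (φs i)) (fs i)) → Den φs N ψ g →
      Den Γ (.letin k Ms N) (.circ ψ) (semLet fs g)

theorem Typing.exists_den {n : ℕ} {Γ : Ctx n} {M : Term n} {φ : Ty} (h : Typing Γ M φ) :
    ∃ f, Den Γ M φ f := by
  induction h with
  | ax Γ i => exact ⟨_, .ax Γ i⟩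
  | lam _ ih => exact ⟨_, .lam ih.choose_spec⟩
  | app _ _ ih ih' => exact ⟨_, .app ih.choose_spec ih'.choose_spec⟩
  | pair _ _ ih ih' => exact ⟨_, .pair ih.choose_spec ih'.choose_spec⟩
  | fst _ ih => exact ⟨_, .fst ih.choose_spec⟩
  | snd _ ih => exact ⟨_, .snd ih.choose_spec⟩
  | pure _ ih => exact ⟨_, .pure ih.choose_spec⟩
  | letin _ _ ih ih' => exact ⟨_, .letin (fun i => (ih i).choose_spec) ih'.choose_spec⟩

/-! ### Renaming and substitution -/

namespace Den

theorem ax_of_eq {n : ℕ} {Γ : Ctx n} {i : Fin n} {φ : Ty} {f : Env n →o Sem φ} (h : Γ i = φ)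
    (hf : ∀ ρ, f ρ = ρ i φ) : Den Γ (.var i) φ f := by
  subst h
  have : f = Env.read i (Γ i) := OrderHom.ext _ _ (funext hf)
  exact this ▸ .ax Γ i

theorem rename {n m : ℕ} {Δ : Ctx n} {M : Term n} {φ : Ty} {f : Env n →o Sem φ}
    (hM : Den Δ M φ f) {Γ : Ctx m} {r : Fin n → Fin m} (hr : ∀ i, Γ (r i) = Δ i) :
    Den Γ (M.rename r) φ (f.comp (Env.pull r)) := by
  induction hM generalizing m with
  | ax Δ i => exact ax_of_eq (hr i) fun _ => rfl
  | @lam n Δ φ ψ M f _ ih =>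
    have h := ih (Γ := Γ.snoc φ)
      (r := Fin.cons (α := fun _ => Fin (m + 1)) 0 fun i => (r i).succ) fun i => by
        refine Fin.cases rfl (fun j => ?_) i
        exact hr j
    have e : (semLam f).comp (Env.pull r) = semLam (φ := φ) (f.comp (Env.pull
        (Fin.cons (α := fun _ => Fin (m + 1)) 0 fun i => (r i).succ))) := by
      refine OrderHom.ext _ _ (funext fun ρ => Arr.ext fun a => ?_)
      refine congrArg (fun τ => (size a + 1) +ᵥ f τ) (funext fun i => ?_)
      exact Fin.cases rfl (fun j => rfl) i
    exact e ▸ .lam h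
  | app _ _ ih ih' => exact .app (ih hr) (ih' hr)
  | pair _ _ ih ih' => exact .pair (ih hr) (ih' hr)
  | fst _ ih => exact .fst (ih hr)
  | snd _ ih => exact .snd (ih hr)
  | pure _ ih => exact .pure (ih hr)
  | letin _ h ih _ => exact .letin (fun i => ih i hr) h

/-- The value of `M [σ]` in `ρ` is the value of `M` in `t ρ`, provided that `t ρ` lists values of
the terms `σ i` at the types of the variables of `M`. -/
theorem subst {n m : ℕ} {Δ : Ctx n} {M : Term n} {φ : Ty} {f : Env n →o Sem φ}
    (hM : Den Δ M φ f) {Γ : Ctx m} {σ : Fin n → Term m} {t : Env m →o Env n}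
    (hσ : ∀ i, Den Γ (σ i) (Δ i) ((Env.read i (Δ i)).comp t)) :
    Den Γ (M.subst σ) φ (f.comp t) := by
  induction hM generalizing m with
  | ax Δ i => exact hσ i
  | @lam n Δ φ ψ M f _ ih =>
    have h := ih (Γ := Γ.snoc φ) (t := Env.lift t)
      (σ := Fin.cons (α := fun _ => Term (m + 1)) (.var 0) fun i => (σ i).rename Fin.succ)
      fun i => by
        refine Fin.cases ?_ (fun j => ?_) i
        · exact ax_of_eq rfl fun _ => rfl
        · exact (hσ j).rename fun _ => rfl
    have e : (semLam f).comp t = semLam (φ := φ) (f.comp (Env.lift t)) := rfl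
    exact e ▸ .lam h
  | app _ _ ih ih' => exact .app (ih hσ) (ih' hσ)
  | pair _ _ ih ih' => exact .pair (ih hσ) (ih' hσ)
  | fst _ ih => exact .fst (ih hσ)
  | snd _ ih => exact .snd (ih hσ)
  | pure _ ih => exact .pure (ih hσ)
  | letin _ h ih _ => exact .letin (fun i => ih i hσ) h

theorem of_eq {n : ℕ} {Γ : Ctx n} {M : Term n} {φ : Ty} {f g : Env n →o Sem φ}
    (h : Den Γ M φ f) (hfg : ∀ ρ, f ρ = g ρ) : Den Γ M φ g :=
  OrderHom.ext f g (funext hfg) ▸ h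

theorem pure_inv {n : ℕ} {Γ : Ctx n} {M : Term n} {φ : Ty} {f : Env n →o Sem (.circ φ)}
    (h : Den Γ (.pure M) (.circ φ) f) : ∃ g, Den Γ M φ g ∧ f = semPure g := by
  cases h with
  | pure h => exact ⟨_, h, rfl⟩

theorem letin_inv {n k : ℕ} {Γ : Ctx n} {Ms : Fin k → Term n} {N : Term k} {φ : Ty}
    {f : Env n →o Sem (.circ φ)} (h : Den Γ (.letin k Ms N) (.circ φ) f) :
    ∃ (φs : Ctx k) (fs : ∀ i, Env n →o Sem (.circ (φs i))) (g : Env k →o Sem φ),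
      (∀ i, Den Γ (Ms i) (.circ (φs i)) (fs i)) ∧ Den φs N φ g ∧ f = semLet fs g := by
  cases h with
  | letin h h' => exact ⟨_, _, _, h, h', rfl⟩

end Den

/-! ### Reduction decreases values -/

/-- `M` has a value at `○φ` that acts on functions of families of values by `V`. The type of `V`
does not depend on `φ`, which allows the values of a sequence of terms to be concatenated. -/
def DenCont {n : ℕ} (Γ : Ctx n) (M : Term n) (φ : Ty) (V : Env n → Cont Val) : Prop :=
  ∃ f, Den Γ M (.circ φ) f ∧ ∀ ρ, toCont (f ρ) = V ρ

open Term (append₃)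

/-- The flattening rule decreases values: the value of the inner `let` exceeds, by its own summand
`1`, the result of running `Ns` and handing the value of `Q` on. -/
theorem Den.exists_den_lt_letLet {n a b c : ℕ} {Γ : Ctx n} {Ms : Fin a → Term n}
    {Ns : Fin b → Term n} {Q : Term b} {Ps : Fin c → Term n} {R : Term (a + 1 + c)} {φ : Ty}
    {f : Env n →o Sem φ}
    (hM : Den Γ (.letin (a + 1 + c) (append₃ Ms (fun _ : Fin 1 => .letin b Ns Q) Ps) R) φ f) :
    ∃ f', Den Γ (.letin (a + b + c) (append₃ Ms Ns Ps) (Term.substMiddle R Q)) φ f' ∧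
      ∀ ρ, 1 +ᵥ f' ρ ≤ f ρ := by
  cases hM with
  | @letin _ _ _ φs ψ _ _ fs g hMs hR =>
    -- The entry in the middle of the sequence of arguments is the inner `let`.
    have hm := hMs (Fin.castAdd c (Fin.natAdd a 0))
    have em : append₃ Ms (fun _ : Fin 1 => Term.letin b Ns Q) Ps
        (Fin.castAdd c (Fin.natAdd a 0)) = Term.letin b Ns Q := by simp [append₃]
    rw [em] at hm
    obtain ⟨ψs, gs, q, hNs, hQ, eq⟩ := hm.letin_inv
    let Δ : Ctx (a + b + c) := Fin.append (Fin.append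
      (fun i => φs (Fin.castAdd c (Fin.castAdd 1 i))) ψs) fun i => φs (Fin.natAdd (a + 1) i)
    let A := fun (ρ : Env n) (i : Fin a) => toCont (fs (Fin.castAdd c (Fin.castAdd 1 i)) ρ)
    let B := fun (ρ : Env n) (i : Fin b) => toCont (gs i ρ)
    let C := fun (ρ : Env n) (i : Fin c) => toCont (fs (Fin.natAdd (a + 1) i) ρ)
    have hV : ∀ i, DenCont Γ (append₃ Ms Ns Ps i) (Δ i) fun ρ =>
        Fin.append (Fin.append (A ρ) (B ρ)) (C ρ) i := by
      refine forall_fin_add_add (fun i => ?_) (fun i => ?_) fun i => ?_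
      · have h := hMs (Fin.castAdd c (Fin.castAdd 1 i))
        simp only [append₃, Δ, Fin.append_left] at h ⊢
        exact ⟨_, h, fun _ => rfl⟩
      · simp only [append₃, Δ, Fin.append_left, Fin.append_right]
        exact ⟨_, hNs i, fun _ => rfl⟩
      · have h := hMs (Fin.natAdd (a + 1) i)
        simp only [append₃, Δ, Fin.append_right] at h ⊢
        exact ⟨_, h, fun _ => rfl⟩
    choose hs hhs hval using hV
    -- `y` gives the value of `Q`, and `t` the environment for `R` that has it in the middle.
    let y : Env b →o Val := (Val.single _).comp q
    let t : Env (a + b + c) →o Env (a + 1 + c) :=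
      ⟨fun ρ => Fin.append (Fin.append (fun i => ρ (Fin.castAdd c (Fin.castAdd b i)))
        fun _ => y fun i => ρ (Fin.castAdd c (Fin.natAdd a i))) fun i => ρ (Fin.natAdd (a + b) i),
        fun _ _ h => append_le_append (append_le_append (fun i => h _)
          fun _ => y.mono fun i => h _) fun i => h _⟩
    have ht : ∀ ρ, t ρ = Fin.append
        (Fin.append (fun i => ρ (Fin.castAdd c (Fin.castAdd b i)))
          fun _ => y fun i => ρ (Fin.castAdd c (Fin.natAdd a i)))
        fun i => ρ (Fin.natAdd (a + b) i) := fun _ => rfl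
    refine ⟨_, .letin hhs (hR.subst (t := t) ?_), fun ρ l => ?_⟩
    · refine forall_fin_add_add (fun i => ?_) (fun i => ?_) fun i => ?_
      · simp only [append₃, Fin.append_left]
        refine .ax_of_eq (by simp [Δ]) fun ρ => ?_
        change t ρ _ _ = _
        rw [ht, Fin.append_left, Fin.append_left]
      · obtain rfl : i = 0 := Subsingleton.elim _ _
        simp only [append₃, Fin.append_left, Fin.append_right]
        refine (hQ.rename fun i => by simp [Δ]).of_eq fun ρ => ?_
        change _ = t ρ _ _
        rw [ht, Fin.append_left, Fin.append_right]
        exact (Val.single_self _ _).symm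
      · simp only [append₃, Fin.append_right]
        refine .ax_of_eq (by simp [Δ]) fun ρ => ?_
        change t ρ _ _ = _
        rw [ht, Fin.append_right]
    · refine Nat.add_le_add_left ?_ 1
      have e : (fun i => toCont (fs i ρ)) = Fin.append (Fin.append (A ρ)
          fun _ : Fin 1 => toCont (semLet gs q ρ)) (C ρ) := by
        refine funext (forall_fin_add_add (fun i => ?_) (fun i => ?_) fun i => ?_)
        · simp only [Fin.append_left, A]
        · obtain rfl : i = 0 := Subsingleton.elim _ _
          simp only [Fin.append_left, Fin.append_right, eq]
        · simp only [Fin.append_right, C]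
      change 1 + (Cont.seq fun i => toCont (hs i ρ)).toFun ((addSize l).comp (g.comp t)) ≤
        (Cont.seq fun i => toCont (fs i ρ)).toFun ((addSize l).comp g)
      simp only [hval, e]
      refine Cont.seq_flatten (A ρ) (B ρ) (C ρ) (y := y) (t := t) (fun k => ?_)
        (fun xs ys zs => ?_) ((addSize l).comp g)
      · exact Nat.add_le_add_left ((Cont.seq _).mono fun _ => Nat.le_add_left _ _) 1
      · simp only [ht, Fin.append_left, Fin.append_right]

/-- Each reduction rule decreases values. -/
theorem Contract.exists_den_lt {n : ℕ} {Γ : Ctx n} {M M' : Term n} {φ : Ty} {f : Env n →o Sem φ}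
    (h : Contract M M') (hM : Den Γ M φ f) :
    ∃ f', Den Γ M' φ f' ∧ ∀ ρ, 1 +ᵥ f' ρ ≤ f ρ := by
  cases h with
  | beta M N =>
    cases hM with
    | @app _ _ φ' _ _ _ _ g hM hN =>
      cases hM with
      | @lam _ _ _ _ _ f hM =>
        let t : Env n →o Env (n + 1) := ⟨fun ρ => Fin.cons (Val.single φ' (g ρ)) ρ,
          fun _ _ h => cons_le_cons ((Val.single φ').mono (g.mono h)) h⟩
        refine ⟨f.comp t, hM.subst fun i => ?_, fun ρ => ?_⟩
        · refine Fin.cases ?_ (fun j => ?_) i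
          · exact hN.of_eq fun ρ => (Val.single_self φ' (g ρ)).symm
          · exact .ax_of_eq rfl fun _ => rfl
        · exact Sized.vadd_le_vadd (by omega) le_rfl
  | fst M N =>
    cases hM with
    | fst hM =>
      cases hM with
      | pair hM hN => exact ⟨_, hM, fun ρ => Sized.vadd_mono 1 (Sized.le_vadd _ _)⟩
  | snd M N =>
    cases hM with
    | snd hM =>
      cases hM with
      | pair hM hN => exact ⟨_, hN, fun ρ => Sized.vadd_mono 1 (Sized.le_vadd _ _)⟩
  | letLet Ms Ns Q Ps R => exact hM.exists_den_lt_letLet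
  | letPure Ms N =>
    cases hM with
    | @letin _ _ _ φs ψ _ _ fs g hMs hN =>
      choose gs hgs hfs using fun i => (hMs i).pure_inv
      let t : Env n →o Env _ := ⟨fun ρ i => Val.single (φs i) (gs i ρ),
        fun _ _ h i => (Val.single (φs i)).mono ((gs i).mono h)⟩
      refine ⟨semPure (g.comp t), .pure (hN.subst fun i => ?_), fun ρ l => ?_⟩
      · exact (hgs i).of_eq fun ρ => (Val.single_self (φs i) (gs i ρ)).symm
      · refine Nat.add_le_add_left (Cont.le_seq (t ρ) (fun i l => ?_) ((addSize l).comp g)) 1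
        rw [hfs]
        exact Nat.le_add_left _ _
  | letEmpty Ms N =>
    cases hM with
    | @letin _ _ _ φs ψ _ _ fs g hMs hN =>
      refine ⟨_, .pure (hN.rename fun i => i.elim0), fun ρ l => ?_⟩
      exact Nat.add_le_add_left (Cont.le_seq _ (fun i => i.elim0) ((addSize l).comp g)) 1

/-- A reduction step decreases values: each constructor of terms is strictly monotone in each of its
arguments. -/
theorem Step.exists_den_lt {n : ℕ} {M M' : Term n} (h : Step M M') {φ : Ty} {Γ : Ctx n}
    {f : Env n →o Sem φ} (hM : Den Γ M φ f) : ∃ f', Den Γ M' φ f' ∧ ∀ ρ, 1 +ᵥ f' ρ ≤ f ρ := by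
  induction h generalizing φ with
  | root h => exact h.exists_den_lt hM
  | lam _ ih =>
    cases hM with
    | lam hM =>
      obtain ⟨f', hf', hlt⟩ := ih hM
      refine ⟨_, .lam hf', fun ρ a => ?_⟩
      -- The padding by `size a + 1` is the same on both sides.
      change 1 +ᵥ _ +ᵥ _ ≤ _
      rw [vadd_comm]
      exact Sized.vadd_mono _ (hlt _)
  | appL N _ ih =>
    cases hM with
    | app hM hN =>
      obtain ⟨f', hf', hlt⟩ := ih hM
      exact ⟨_, .app hf' hN, fun ρ => hlt ρ _⟩
  | appR M _ ih =>
    cases hM with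
    | @app _ _ φ' _ _ _ f _ hM hN =>
      obtain ⟨f', hf', hlt⟩ := ih hN
      exact ⟨_, .app hM hf', fun ρ => Arr.incr (α := Sem φ') (β := Sem φ) (f ρ) 1 (hlt ρ)⟩
  | pairL N _ ih =>
    cases hM with
    | pair hM hN =>
      obtain ⟨f', hf', hlt⟩ := ih hM
      refine ⟨_, .pair hf' hN, fun ρ => ⟨?_, ?_⟩⟩
      · change 1 +ᵥ _ +ᵥ _ ≤ _
        rw [vadd_comm]
        exact Sized.vadd_mono _ (hlt ρ)
      · exact Sized.vadd_vadd_le (Sized.size_mono (hlt ρ)) le_rfl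
  | pairR M _ ih =>
    cases hM with
    | pair hM hN =>
      obtain ⟨f', hf', hlt⟩ := ih hN
      refine ⟨_, .pair hM hf', fun ρ => ⟨?_, ?_⟩⟩
      · exact Sized.vadd_vadd_le (Sized.size_mono (hlt ρ)) le_rfl
      · change 1 +ᵥ _ +ᵥ _ ≤ _
        rw [vadd_comm]
        exact Sized.vadd_mono _ (hlt ρ)
  | fst _ ih =>
    cases hM with
    | fst hM =>
      obtain ⟨f', hf', hlt⟩ := ih hM
      exact ⟨_, .fst hf', fun ρ => Sized.vadd_mono 1 (hlt ρ).1⟩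
  | snd _ ih =>
    cases hM with
    | snd hM =>
      obtain ⟨f', hf', hlt⟩ := ih hM
      exact ⟨_, .snd hf', fun ρ => Sized.vadd_mono 1 (hlt ρ).2⟩
  | pure _ ih =>
    cases hM with
    | pure hM =>
      obtain ⟨f', hf', hlt⟩ := ih hM
      exact ⟨_, .pure hf', fun ρ l => addSize_incr l (hlt ρ)⟩
  | letArg Ms i N _ ih =>
    cases hM with
    | @letin _ _ _ φs _ _ _ fs g hMs hN =>
      obtain ⟨f', hf', hlt⟩ := ih (hMs i)
      refine ⟨_, .letin (fs := Function.update fs i f') (fun j => ?_) hN, fun ρ l => ?_⟩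
      · by_cases e : j = i
        · subst e
          simpa using hf'
        · simpa [e] using hMs j
      · change 1 + (1 + _) ≤ 1 + _
        refine Nat.add_le_add_left (Cont.seq_incr i (fun j l => ?_) (fun l => ?_) _) 1
        · by_cases e : j = i
          · subst e
            rw [Function.update_self]
            exact Sized.le_of_vadd_le (hlt ρ) _
          · simp [e]
        · rw [Function.update_self]
          exact hlt ρ _
  | letBody Ms _ ih =>
    cases hM with
    | letin hMs hN =>
      obtain ⟨f', hf', hlt⟩ := ih hN
      refine ⟨_, .letin hMs hf', fun ρ l => ?_⟩
      exact Nat.add_le_add_left ((Cont.seq _).incr 1 fun xs => addSize_incr l (hlt xs)) 1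

theorem Den.stronglyNormalising {n : ℕ} {Γ : Ctx n} {M : Term n} {φ : Ty} {f : Env n →o Sem φ}
    (hM : Den Γ M φ f) : StronglyNormalising M := by
  rintro ⟨s, rfl, hs⟩
  induction h : size (f fun _ _ => base) using Nat.strong_induction_on generalizing s f with
  | _ m ih =>
    obtain ⟨f', hf', hlt⟩ := (hs 0).exists_den_lt hM
    have := Sized.size_mono (hlt fun _ _ => base)
    exact ih _ (by omega) (fun i => s (i + 1)) (fun i => hs (i + 1)) hf' rfl

end IELMinus

theorem mainTheorem2 {n : ℕ} (Γ : IELMinus.Ctx n) (M : IELMinus.Term n) (φ : IELMinus.Ty)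
    (hM : IELMinus.Typing Γ M φ) : IELMinus.StronglyNormalising M := by
  obtain ⟨f, hf⟩ := hM.exists_den
  exact hf.stronglyNormalising
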